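/- Let $N\ge 1$. For $f:\mathbb Z^N\to\mathbb R$ put $\Delta_N f(\mathbf n)=\sum_{k=1}^N[f(\mathbf n+\mathbf e_k)+f(\mathbf n-\mathbf e_k)-2f(\mathbf n)]$, where $\mathbf e_1,\dots,\mathbf e_N$ are the standard unit vectors, and, for bounded $f$ and $t\ge0$, let $e^{t\Delta_N}f=\sum_{j\ge0}\frac{t^j}{j!}\Delta_N^jf$ be the heat semigroup. For finitely supported $f$ and $-N/2<s<0$ define the discrete Riesz potential $$(-\Delta_N)^sf(\mathbf n)=\frac1{\Gamma(-s)}\int_0^\infty e^{t\Delta_N}f(\mathbf n)\,\frac{dt}{t^{s+1}},$$ and $(-\Delta_N)^0f=f$. Let $G_{t,N}(\mathbf m)=\prod_{k=1}^N e^{-2t}I_{m_k}(2t)$ for $\mathbf m=(m_1,\dots,m_N)\in\mathbb Z^N$, where $I_a$ is the modified Bessel function of the first kind, and let $$K(\mathbf m)=\int_0^\infty G_{t,N}(\mathbf m)\frac{dt}{t}\quad(\mathbf m\ne\mathbf 0),\qquad K(\mathbf 0)=0,$$ $$\rho_N=\sum_{\mathbf m\ne\mathbf 0}\int_0^1G_{t,N}(\mathbf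 m)\frac{dt}{t}-\int_1^\infty G_{t,N}(\mathbf 0)\frac{dt}{t}-\gamma,$$ where $\gamma$ is the Euler–Mascheroni constant. **Theorem.** The integrals and the series defining $K$ and $\rho_N$ converge. Let $f:\mathbb Z^N\to\mathbb R$ have finite support. For every $-N/2<s<0$ the integral defining $(-\Delta_N)^sf(\mathbf n)$ converges absolutely for every $\mathbf n\in\mathbb Z^N$, and $(-\Delta_N)^sf\in\ell^\infty(\mathbb Z^N)$. For every $\mathbf n\in\mathbb Z^N$ the left derivative $$\log(-\Delta_N)f(\mathbf n):=\left.\frac{d}{ds}(-\Delta_N)^s\right|_{s=0^-}f(\mathbf n)$$ exists, and $$\log(-\Delta_N)f(\mathbf n)=-\sum_{\mathbf m\in\mathbb Z^N,\ \mathbf m\ne\mathbf n}K(\mathbf n-\mathbf m)f(\mathbf m)+\rho_Nf(\mathbf n).$$ Moreover $\log(-\Delta_N)f\in\ell^\infty(\mathbb Z^N)$ and $$\lim_{s\to0^-}\left\|\frac{(-\Delta_N)^sf-f}{s}-\log(-\Delta_N)f\right\|_{\ell^\infty(\mathbb Z^N)}=0.$$ -/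

import Mathlib

open Filter Topology MeasureTheory
open scoped Nat ENNReal

noncomputable section

namespace DiscreteRiesz

/-- The discrete Laplacian on `ℤ^N`:
`Δ f(n) = ∑ₖ (f(n + eₖ) + f(n - eₖ) - 2 f(n))`. -/
def laplacian (N : ℕ) (f : (Fin N → ℤ) → ℝ) : (Fin N → ℤ) → ℝ := fun n =>
  ∑ k : Fin N, (f (n + Pi.single k 1) + f (n - Pi.single k 1) - 2 * f n)

/-- The heat semigroup `e^{tΔ} f = ∑ⱼ tʲ/j! Δʲ f`. As `Δ` is a bounded operator on `ℓ^∞(ℤ^N)`,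
the series converges absolutely for every bounded `f`. -/
def heatSemigroup (N : ℕ) (t : ℝ) (f : (Fin N → ℤ) → ℝ) : (Fin N → ℤ) → ℝ := fun n =>
  ∑' j : ℕ, t ^ j / (j ! : ℝ) * ((laplacian N)^[j] f) n

/-- The power `(-Δ)^s` for `-N/2 < s < 0` (the discrete Riesz potential), through the heat
semigroup: `(-Δ)^s f = 1/Γ(-s) ∫₀^∞ e^{tΔ} f dt/t^{s+1}`; moreover `(-Δ)^0` is the identity.
Other values of `s` are not used. -/
def negLaplacianPow (N : ℕ) (s : ℝ) (f : (Fin N → ℤ) → ℝ) : (Fin N → ℤ) → ℝ := fun n =>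
  if s = 0 then f n
  else (Real.Gamma (-s))⁻¹ * ∫ t in Set.Ioi (0 : ℝ), heatSemigroup N t f n / t ^ (s + 1)

/-- `log(-Δ) f`, the (pointwise) left derivative of `s ↦ (-Δ)^s f` at `s = 0`. -/
def logNegLaplacian (N : ℕ) (f : (Fin N → ℤ) → ℝ) : (Fin N → ℤ) → ℝ := fun n =>
  derivWithin (fun s : ℝ => negLaplacianPow N s f n) (Set.Iic 0) 0

/-- The modified Bessel function of the first kind of integer order `a`,
`I_a(x) = ∑ⱼ (x/2)^(2j+|a|) / (j! (j+|a|)!)`; recall that `I_{-a} = I_a` for integers `a`. -/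
def besselI (a : ℤ) (x : ℝ) : ℝ :=
  ∑' j : ℕ, (x / 2) ^ (2 * j + a.natAbs) / ((j ! : ℝ) * ((j + a.natAbs)! : ℝ))

/-- The heat kernel `G_{t,N}(m) = ∏ₖ e^{-2t} I_{mₖ}(2t)`. -/
def heatKernel (N : ℕ) (t : ℝ) (m : Fin N → ℤ) : ℝ :=
  ∏ k : Fin N, (Real.exp (-2 * t) * besselI (m k) (2 * t))

/-- The kernel `K(m) = ∫₀^∞ G_{t,N}(m) dt/t` for `m ≠ 0`, and `K(0) = 0`. -/
def kernelK (N : ℕ) (m : Fin N → ℤ) : ℝ :=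
  if m = 0 then 0 else ∫ t in Set.Ioi (0 : ℝ), heatKernel N t m / t

/-- The corrector
`ρ_N = ∑_{m ≠ 0} ∫₀¹ G_{t,N}(m) dt/t - ∫₁^∞ G_{t,N}(0) dt/t - γ`. -/
def corrector (N : ℕ) : ℝ :=
  (∑' m : {m : Fin N → ℤ // m ≠ 0}, ∫ t in Set.Ioc (0 : ℝ) 1, heatKernel N t m / t)
    - (∫ t in Set.Ioi (1 : ℝ), heatKernel N t 0 / t)
    - Real.eulerMascheroniConstant

end DiscreteRiesz

end

namespace DiscreteRiesz

/-! ### Fourier representation of the heat semigroup -/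

theorem hasSum_integral_exp {α : Type*} [MeasurableSpace α] (μ : Measure α) [IsFiniteMeasure μ]
    {w h : α → ℝ} (hw : Measurable w) (hh : Measurable h) {C D : ℝ} (hC : ∀ x, |w x| ≤ C)
    (hD : ∀ x, |h x| ≤ D) (t : ℝ) :
    HasSum (fun j : ℕ => t ^ j / (j ! : ℝ) * ∫ x, w x ^ j * h x ∂μ)
      (∫ x, Real.exp (t * w x) * h x ∂μ) := by
  simp_rw [← integral_const_mul]
  have hs : Summable fun j : ℕ => (|t| * C) ^ j / (j ! : ℝ) * D :=
    (Real.summable_pow_div_factorial _).mul_right D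
  refine hasSum_integral_of_dominated_convergence
    (fun (j : ℕ) _ => (|t| * C) ^ j / (j ! : ℝ) * D) (fun j => ?_) (fun j => ?_) ?_ ?_ ?_
  · exact (((hw.pow_const j).mul hh).const_mul _).aestronglyMeasurable
  · refine Eventually.of_forall fun x => ?_
    have hCx := hC x
    have hC0 : 0 ≤ C := (abs_nonneg _).trans hCx
    rw [Real.norm_eq_abs, ← mul_assoc, abs_mul, abs_mul, abs_div, abs_pow, abs_pow,
      Nat.abs_cast, mul_pow, mul_div_right_comm]
    gcongr
    exact hD x
  · exact Eventually.of_forall fun _ => hs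
  · exact integrable_const _
  · refine Eventually.of_forall fun x => ?_
    have := (NormedSpace.expSeries_div_hasSum_exp (t * w x)).mul_right (h x)
    rw [← Real.exp_eq_exp_ℝ] at this
    refine this.congr_fun ?_
    intro j
    ring

/-- Lebesgue measure on the circle, represented by `(-π, π]`. -/
noncomputable def circleMeasure : Measure ℝ := volume.restrict (Set.Ioc (-Real.pi) Real.pi)

instance : IsFiniteMeasure circleMeasure := by
  unfold circleMeasure; infer_instance

theorem integrable_circleMeasure {f : ℝ → ℝ} (hf : Continuous f) : Integrable f circleMeasure :=
  (hf.integrableOn_Icc (a := -Real.pi) (b := Real.pi)).mono_set Set.Ioc_subset_Icc_self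

theorem integral_cos_int_mul (a : ℤ) :
    ∫ x, Real.cos (a * x) ∂circleMeasure = if a = 0 then 2 * Real.pi else 0 := by
  rw [circleMeasure, ← intervalIntegral.integral_of_le (by linarith [Real.pi_pos])]
  split_ifs with h
  · simp [h]; ring
  · have : (a : ℝ) ≠ 0 := by exact_mod_cast h
    rw [intervalIntegral.integral_comp_mul_left (fun x => Real.cos x) this, integral_cos]
    simp [Real.sin_int_mul_pi]

/-- The Fourier coefficients of `(2 cos θ)^j`, up to the factor `2π`. -/
noncomputable def cosMoment (j : ℕ) (a : ℤ) : ℝ :=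
  ∫ x, (2 * Real.cos x) ^ j * Real.cos (a * x) ∂circleMeasure

theorem cosMoment_zero (a : ℤ) : cosMoment 0 a = if a = 0 then 2 * Real.pi else 0 := by
  simp [cosMoment, integral_cos_int_mul]

theorem cosMoment_succ (j : ℕ) (a : ℤ) :
    cosMoment (j + 1) a = cosMoment j (a + 1) + cosMoment j (a - 1) := by
  unfold cosMoment
  rw [← integral_add (integrable_circleMeasure (by fun_prop))
    (integrable_circleMeasure (by fun_prop))]
  congr 1; ext x
  push_cast
  rw [add_mul, sub_mul, one_mul, Real.cos_add, Real.cos_sub]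
  ring

theorem cosMoment_eq_zero_of_lt (j : ℕ) (a : ℤ) (h : (j : ℤ) < |a|) : cosMoment j a = 0 := by
  induction j generalizing a with
  | zero => rw [cosMoment_zero, if_neg]; rintro rfl; simp at h
  | succ j ih =>
    push_cast at h
    rw [cosMoment_succ, ih, ih, add_zero] <;> grind

theorem cosMoment_eq_zero_of_odd (j : ℕ) (a : ℤ) (h : ¬ (2 : ℤ) ∣ j - a) : cosMoment j a = 0 := by
  induction j generalizing a with
  | zero => rw [cosMoment_zero, if_neg]; rintro rfl; simp at h
  | succ j ih =>
    push_cast at h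
    rw [cosMoment_succ, ih, ih, add_zero] <;> omega

theorem cosMoment_add (p q : ℕ) :
    cosMoment (p + q) (p - q) = 2 * Real.pi * (p + q).choose p := by
  induction h : p + q generalizing p q with
  | zero =>
    obtain ⟨rfl, rfl⟩ : p = 0 ∧ q = 0 := by omega
    simp [cosMoment_zero]
  | succ k ih =>
    rw [cosMoment_succ]
    rcases p with _ | p
    · obtain ⟨q, rfl⟩ : ∃ q', q = q' + 1 := ⟨q - 1, by omega⟩
      have h1 := ih 0 q (by omega)
      rw [cosMoment_eq_zero_of_lt k (_ - 1) (by push_cast; grind)]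
      push_cast at h1 ⊢
      rw [show (0 : ℤ) - (q + 1) + 1 = 0 - q by ring, h1]
      simp
    · rcases q with _ | q
      · have h1 := ih p 0 (by omega)
        rw [cosMoment_eq_zero_of_lt k (_ + 1) (by push_cast; grind)]
        push_cast at h1 ⊢
        rw [show (p : ℤ) + 1 - 0 - 1 = p - 0 by ring, h1]
        obtain rfl : k = p := by omega
        simp
      · have h1 := ih (p + 1) q (by omega)
        have h2 := ih p (q + 1) (by omega)
        push_cast at h1 h2 ⊢
        rw [show (p : ℤ) + 1 - (q + 1) + 1 = p + 1 - q by ring,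
          show (p : ℤ) + 1 - (q + 1) - 1 = p - (q + 1) by ring, h1, h2, Nat.choose_succ_succ]
        push_cast; ring

theorem cosMoment_neg (j : ℕ) (a : ℤ) : cosMoment j (-a) = cosMoment j a := by
  simp [cosMoment]

theorem hasSum_besselI (a : ℤ) (t : ℝ) :
    HasSum (fun i : ℕ => t ^ (2 * i + a.natAbs) / ((i ! : ℝ) * ((i + a.natAbs)! : ℝ)))
      ((2 * Real.pi)⁻¹ * ∫ x, Real.exp (t * (2 * Real.cos x)) * Real.cos (a * x) ∂circleMeasure) := by
  have h := (hasSum_integral_exp circleMeasure (w := fun x => 2 * Real.cos x)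
    (h := fun x => Real.cos (a * x)) (by fun_prop) (by fun_prop) (C := 2) (D := 1)
    (fun x => by rw [abs_mul, abs_two]; linarith [Real.abs_cos_le_one x])
    (fun x => Real.abs_cos_le_one _) t).mul_left (2 * Real.pi)⁻¹
  change HasSum (fun j : ℕ => (2 * Real.pi)⁻¹ * (t ^ j / (j ! : ℝ) * cosMoment j a)) _ at h
  have hinj : Function.Injective fun i : ℕ => 2 * i + a.natAbs := fun i j hij => by
    simp only at hij; omega
  have habs : ∀ j, cosMoment j a = cosMoment j a.natAbs := fun j => by
    rcases Int.natAbs_eq a with h | h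
    · rw [← h]
    · conv_lhs => rw [h]
      rw [cosMoment_neg]
  rw [← hinj.hasSum_iff] at h
  · refine h.congr_fun fun i => ?_
    have h1 := cosMoment_add (i + a.natAbs) i
    rw [show ((i + a.natAbs : ℕ) : ℤ) - i = a.natAbs by push_cast; ring,
      show i + a.natAbs + i = 2 * i + a.natAbs by ring] at h1
    simp only [Function.comp]
    rw [habs, h1, Nat.choose_eq_factorial_div_factorial (by omega),
      Nat.cast_div (Nat.factorial_mul_factorial_dvd_factorial (by omega)) (by positivity),
      show 2 * i + a.natAbs - (i + a.natAbs) = i by omega]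
    have := Real.pi_ne_zero
    push_cast
    field_simp
  · intro j hj
    rw [habs]
    by_cases hodd : (2 : ℤ) ∣ j - a.natAbs
    · rw [cosMoment_eq_zero_of_lt]
      · simp
      · by_contra hlt
        apply hj
        obtain ⟨c, hc⟩ := hodd
        refine ⟨c.toNat, ?_⟩
        simp only
        have : |(a.natAbs : ℤ)| = a.natAbs := abs_of_nonneg (by positivity)
        omega
    · rw [cosMoment_eq_zero_of_odd j _ hodd]; simp

theorem hasSum_besselI' (a : ℤ) (t : ℝ) :
    HasSum (fun i : ℕ => t ^ (2 * i + a.natAbs) / ((i ! : ℝ) * ((i + a.natAbs)! : ℝ)))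
      (besselI a (2 * t)) := by
  have h := (hasSum_besselI a t).summable.hasSum
  simpa [besselI] using h

/-- The one-dimensional heat kernel. -/
noncomputable def heatKernel₁ (t : ℝ) (a : ℤ) : ℝ := Real.exp (-2 * t) * besselI a (2 * t)

theorem heatKernel_eq (N : ℕ) (t : ℝ) (m : Fin N → ℤ) :
    heatKernel N t m = ∏ k, heatKernel₁ t (m k) := rfl

theorem heatKernel₁_eq_integral (t : ℝ) (a : ℤ) :
    heatKernel₁ t a =
      ∫ x, Real.exp (t * (2 * Real.cos x - 2)) * (Real.cos (a * x) / (2 * Real.pi))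
        ∂circleMeasure := by
  rw [heatKernel₁, (hasSum_besselI' a t).unique (hasSum_besselI a t), ← mul_assoc,
    ← integral_const_mul]
  congr 1; ext x
  rw [show t * (2 * Real.cos x - 2) = -2 * t + t * (2 * Real.cos x) by ring, Real.exp_add]
  ring

theorem continuous_heatKernel₁ (a : ℤ) : Continuous fun t => heatKernel₁ t a := by
  simp_rw [heatKernel₁_eq_integral, circleMeasure]
  have := intervalIntegral.continuous_parametric_intervalIntegral_of_continuous' (μ := volume)
    (f := fun t x : ℝ =>
      Real.exp (t * (2 * Real.cos x - 2)) * (Real.cos (a * x) / (2 * Real.pi)))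
    (by unfold Function.uncurry; fun_prop) (-Real.pi) Real.pi
  simpa only [intervalIntegral.integral_of_le (by linarith [Real.pi_pos] : -Real.pi ≤ Real.pi)]
    using this

theorem continuous_heatKernel (N : ℕ) (m : Fin N → ℤ) : Continuous fun t => heatKernel N t m := by
  simp_rw [heatKernel_eq]
  exact continuous_finsetProd _ fun k _ => continuous_heatKernel₁ _

/-- The kernel of `Δ^j`. -/
noncomputable def laplacianPowKernel (N j : ℕ) (m : Fin N → ℤ) : ℝ :=
  ∫ x : Fin N → ℝ, (∑ k, (2 * Real.cos (x k) - 2)) ^ j *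
    ∏ k, (Real.cos (m k * x k) / (2 * Real.pi)) ∂Measure.pi fun _ => circleMeasure

theorem abs_sum_cos_le (N : ℕ) (x : Fin N → ℝ) : |∑ k, (2 * Real.cos (x k) - 2)| ≤ 4 * N := by
  refine (Finset.abs_sum_le_sum_abs _ _).trans ?_
  refine (Finset.sum_le_card_nsmul _ _ 4 fun k _ => ?_).trans (by simp [mul_comm])
  rw [abs_le]
  constructor <;> linarith [Real.cos_le_one (x k), Real.neg_one_le_cos (x k)]

theorem abs_prod_cos_le (N : ℕ) (m : Fin N → ℤ) (x : Fin N → ℝ) :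
    |∏ k, (Real.cos (m k * x k) / (2 * Real.pi))| ≤ 1 := by
  rw [Finset.abs_prod]
  refine Finset.prod_le_one (fun _ _ => abs_nonneg _) fun k _ => ?_
  rw [abs_div, abs_of_pos (by positivity : 0 < 2 * Real.pi), div_le_one (by positivity)]
  linarith [Real.abs_cos_le_one (m k * x k), Real.pi_gt_three]

theorem integrable_laplacianPowKernel (N j : ℕ) (m : Fin N → ℤ) :
    Integrable (fun x : Fin N → ℝ => (∑ k, (2 * Real.cos (x k) - 2)) ^ j *
      ∏ k, (Real.cos (m k * x k) / (2 * Real.pi))) (Measure.pi fun _ => circleMeasure) := by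
  refine Integrable.of_bound (C := (4 * N) ^ j * 1) ?_ (Eventually.of_forall fun x => ?_)
  · exact Continuous.aestronglyMeasurable (by fun_prop)
  · rw [norm_mul, norm_pow]
    gcongr
    · exact abs_sum_cos_le N x
    · exact abs_prod_cos_le N m x

theorem laplacianPowKernel_zero (N : ℕ) (m : Fin N → ℤ) :
    laplacianPowKernel N 0 m = if m = 0 then 1 else 0 := by
  simp only [laplacianPowKernel, pow_zero, one_mul]
  rw [integral_fintype_prod_eq_prod (fun k x => Real.cos (m k * x) / (2 * Real.pi))]
  simp_rw [integral_div, integral_cos_int_mul]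
  split_ifs with h
  · subst h
    simp [Real.pi_ne_zero]
  · obtain ⟨k, hk⟩ := Function.ne_iff.1 h
    exact Finset.prod_eq_zero (Finset.mem_univ k) (by simp [show m k ≠ 0 from hk])

theorem laplacian_laplacianPowKernel (N j : ℕ) (m : Fin N → ℤ) :
    laplacian N (laplacianPowKernel N j) m = laplacianPowKernel N (j + 1) m := by
  have hI := integrable_laplacianPowKernel N j
  unfold laplacian
  have : ∀ k, laplacianPowKernel N j (m + Pi.single k 1) + laplacianPowKernel N j (m - Pi.single k 1)
      - 2 * laplacianPowKernel N j m = ∫ x : Fin N → ℝ, (2 * Real.cos (x k) - 2) *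
        ((∑ k, (2 * Real.cos (x k) - 2)) ^ j * ∏ k, (Real.cos (m k * x k) / (2 * Real.pi)))
          ∂Measure.pi fun _ => circleMeasure := by
    intro k
    unfold laplacianPowKernel
    rw [← integral_const_mul, ← integral_add (hI _) (hI _)]
    refine (integral_sub ((hI _).add (hI _)) ((hI m).const_mul 2)).symm.trans ?_
    congr 1; ext x
    simp only [Fintype.prod_eq_mul_prod_compl k, Pi.add_apply, Pi.sub_apply, Pi.single_eq_same]
    have h1 : ∀ i ∈ ({k} : Finset (Fin N))ᶜ, (Pi.single k (1 : ℤ) : Fin N → ℤ) i = 0 := by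
      intro i hi
      simp only [Finset.mem_compl, Finset.mem_singleton] at hi
      exact Pi.single_eq_of_ne hi _
    have h2 : ∏ i ∈ ({k} : Finset (Fin N))ᶜ,
        Real.cos (((m i + (Pi.single k (1 : ℤ) : Fin N → ℤ) i : ℤ) : ℝ) * x i) / (2 * Real.pi) =
        ∏ i ∈ ({k} : Finset (Fin N))ᶜ, Real.cos (m i * x i) / (2 * Real.pi) :=
      Finset.prod_congr rfl fun i hi => by rw [h1 i hi, add_zero]
    have h3 : ∏ i ∈ ({k} : Finset (Fin N))ᶜ,
        Real.cos (((m i - (Pi.single k (1 : ℤ) : Fin N → ℤ) i : ℤ) : ℝ) * x i) / (2 * Real.pi) =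
        ∏ i ∈ ({k} : Finset (Fin N))ᶜ, Real.cos (m i * x i) / (2 * Real.pi) :=
      Finset.prod_congr rfl fun i hi => by rw [h1 i hi, sub_zero]
    rw [h2, h3]
    push_cast
    rw [add_mul, sub_mul, one_mul, Real.cos_add, Real.cos_sub]
    ring
  simp_rw [this]
  rw [← integral_finsetSum]
  · unfold laplacianPowKernel
    congr 1; ext x
    rw [← Finset.sum_mul, pow_succ]
    ring
  · intro k _
    refine (hI m).bdd_mul (c := 4) ?_ (Eventually.of_forall fun x => ?_)
    · exact Continuous.aestronglyMeasurable (by fun_prop)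
    · rw [Real.norm_eq_abs, abs_le]
      constructor <;> linarith [Real.cos_le_one (x k), Real.neg_one_le_cos (x k)]

theorem hasSum_laplacianPowKernel (N : ℕ) (t : ℝ) (m : Fin N → ℤ) :
    HasSum (fun j : ℕ => t ^ j / (j ! : ℝ) * laplacianPowKernel N j m) (heatKernel N t m) := by
  have h := hasSum_integral_exp (Measure.pi fun _ : Fin N => circleMeasure)
    (w := fun x => ∑ k, (2 * Real.cos (x k) - 2))
    (h := fun x => ∏ k, (Real.cos (m k * x k) / (2 * Real.pi))) (by fun_prop) (by fun_prop)
    (abs_sum_cos_le N) (abs_prod_cos_le N m) t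
  have h2 : ∀ x : Fin N → ℝ, Real.exp (t * ∑ k, (2 * Real.cos (x k) - 2)) *
      ∏ k, (Real.cos (m k * x k) / (2 * Real.pi)) = ∏ k, (Real.exp (t * (2 * Real.cos (x k) - 2)) *
      (Real.cos (m k * x k) / (2 * Real.pi))) := fun x => by
    rw [Finset.mul_sum, Real.exp_sum, Finset.prod_mul_distrib]
  simp_rw [h2] at h
  rw [integral_fintype_prod_eq_prod (fun k x => Real.exp (t * (2 * Real.cos x - 2)) *
    (Real.cos (m k * x) / (2 * Real.pi)))] at h
  simpa only [heatKernel_eq, heatKernel₁_eq_integral, laplacianPowKernel] using h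

theorem laplacian_sum_translate {N : ℕ} (S : Finset (Fin N → ℤ)) (f h : (Fin N → ℤ) → ℝ) :
    laplacian N (fun n => ∑ m ∈ S, f m * h (n - m)) =
      fun n => ∑ m ∈ S, f m * laplacian N h (n - m) := by
  ext n
  simp only [laplacian, Finset.mul_sum]
  rw [Finset.sum_comm (s := S)]
  refine Finset.sum_congr rfl fun k _ => ?_
  rw [← Finset.sum_add_distrib, ← Finset.sum_sub_distrib]
  refine Finset.sum_congr rfl fun m _ => ?_
  rw [show n + Pi.single k 1 - m = n - m + Pi.single k 1 by abel,
    show n - Pi.single k 1 - m = n - m - Pi.single k 1 by abel]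
  ring

theorem eq_sum_ite {N : ℕ} {S : Finset (Fin N → ℤ)} {f : (Fin N → ℤ) → ℝ}
    (hS : Function.support f ⊆ S) (n : Fin N → ℤ) :
    f n = ∑ m ∈ S, f m * if n - m = 0 then 1 else 0 := by
  simp only [sub_eq_zero, mul_ite, mul_one, mul_zero, Finset.sum_ite_eq]
  split_ifs with h
  · rfl
  · by_contra h'
    exact h (hS h')

theorem iterate_laplacian {N : ℕ} {S : Finset (Fin N → ℤ)} {f : (Fin N → ℤ) → ℝ}
    (hS : Function.support f ⊆ S) (j : ℕ) :
    (laplacian N)^[j] f = fun n => ∑ m ∈ S, f m * laplacianPowKernel N j (n - m) := by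
  induction j with
  | zero =>
    ext n
    simp only [laplacianPowKernel_zero, Function.iterate_zero, id]
    exact eq_sum_ite hS n
  | succ j ih =>
    rw [Function.iterate_succ_apply', ih, laplacian_sum_translate]
    simp_rw [laplacian_laplacianPowKernel]

theorem heatSemigroup_eq_sum {N : ℕ} {S : Finset (Fin N → ℤ)} {f : (Fin N → ℤ) → ℝ}
    (hS : Function.support f ⊆ S) (t : ℝ) (n : Fin N → ℤ) :
    heatSemigroup N t f n = ∑ m ∈ S, f m * heatKernel N t (n - m) := by
  refine HasSum.tsum_eq ?_
  simp_rw [iterate_laplacian hS, Finset.mul_sum]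
  refine hasSum_sum fun m _ => ?_
  simpa only [mul_left_comm] using (hasSum_laplacianPowKernel N t (n - m)).mul_left (f m)


/-! ### Positivity, mass and decay of the heat kernel -/

theorem heatKernel₁_nonneg {t : ℝ} (ht : 0 ≤ t) (a : ℤ) : 0 ≤ heatKernel₁ t a :=
  mul_nonneg (Real.exp_pos _).le ((hasSum_besselI' a t).nonneg fun i => by positivity)

theorem exp_le_heatKernel₁_zero {t : ℝ} (ht : 0 ≤ t) : Real.exp (-2 * t) ≤ heatKernel₁ t 0 := by
  have h : 1 ≤ besselI 0 (2 * t) := by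
    simpa using le_hasSum (hasSum_besselI' 0 t) 0 fun i _ => by positivity
  exact le_mul_of_one_le_right (Real.exp_pos _).le h

/-- The bijection `ℤ × ℕ ≃ ℕ × ℕ` sending `(a, j)` to `(j + a⁺, j + a⁻)`. -/
def diffMinEquiv : ℤ × ℕ ≃ ℕ × ℕ where
  toFun x := (x.2 + x.1.toNat, x.2 + (-x.1).toNat)
  invFun y := ((y.1 : ℤ) - y.2, min y.1 y.2)
  left_inv x := by ext <;> simp <;> omega
  right_inv y := by ext <;> simp <;> omega

theorem hasSum_pow_div_factorial_mul (t : ℝ) :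
    HasSum (fun y : ℕ × ℕ => t ^ y.1 / (y.1 ! : ℝ) * (t ^ y.2 / (y.2 ! : ℝ)))
      (Real.exp t * Real.exp t) := by
  have hnorm : Summable fun n : ℕ => ‖t ^ n / (n ! : ℝ)‖ :=
    (Real.summable_pow_div_factorial t).norm
  have hexp : HasSum (fun n : ℕ => t ^ n / (n ! : ℝ)) (Real.exp t) := by
    rw [Real.exp_eq_exp_ℝ]
    exact NormedSpace.expSeries_div_hasSum_exp t
  have hmul := summable_mul_of_summable_norm hnorm hnorm
  have h := hmul.hasSum
  rwa [← tsum_mul_tsum_of_summable_norm hnorm hnorm, hexp.tsum_eq] at h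

theorem hasSum_besselI_int (t : ℝ) :
    HasSum (fun a => besselI a (2 * t)) (Real.exp t * Real.exp t) := by
  have h3 : HasSum (fun x : ℤ × ℕ =>
      t ^ (2 * x.2 + x.1.natAbs) / ((x.2 ! : ℝ) * ((x.2 + x.1.natAbs)! : ℝ)))
      (Real.exp t * Real.exp t) := by
    refine (diffMinEquiv.hasSum_iff.2 (hasSum_pow_div_factorial_mul t)).congr_fun ?_
    rintro ⟨a, j⟩
    simp only [diffMinEquiv, Function.comp_apply, Equiv.coe_fn_mk]
    rw [div_mul_div_comm, ← pow_add]
    rcases le_total 0 a with ha | ha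
    · rw [show (-a).toNat = 0 by omega, show a.toNat = a.natAbs by omega, add_zero,
        mul_comm (((j + _)! : ℕ) : ℝ), show j + a.natAbs + j = 2 * j + a.natAbs by omega]
    · rw [show a.toNat = 0 by omega, show (-a).toNat = a.natAbs by omega, add_zero,
        show j + (j + a.natAbs) = 2 * j + a.natAbs by omega]
  exact h3.prod_fiberwise fun a => hasSum_besselI' a t

theorem hasSum_heatKernel₁ (t : ℝ) : HasSum (heatKernel₁ t) 1 := by
  have h := (hasSum_besselI_int t).mul_left (Real.exp (-2 * t))
  rwa [← Real.exp_add, ← Real.exp_add, show -2 * t + (t + t) = 0 by ring, Real.exp_zero] at h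

theorem hasSum_pi_prod_of_nonneg {ι κ : Type*} [Fintype ι] {g : κ → ℝ} {a : ℝ}
    (hg : ∀ i, 0 ≤ g i) (h : HasSum g a) :
    HasSum (fun m : ι → κ => ∏ k, g (m k)) (a ^ Fintype.card ι) := by
  classical
  have hbox : Tendsto (fun s : Finset κ => ∑ m ∈ Fintype.piFinset fun _ : ι => s, ∏ k, g (m k))
      atTop (𝓝 (a ^ Fintype.card ι)) := by
    have h1 : Tendsto (fun s : Finset κ => (∑ i ∈ s, g i) ^ Fintype.card ι) atTop
        (𝓝 (a ^ Fintype.card ι)) := Tendsto.pow h _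
    refine h1.congr fun s => ?_
    rw [← Finset.prod_univ_sum]
    simp
  have hpos : ∀ m : ι → κ, 0 ≤ ∏ k, g (m k) := fun m => Finset.prod_nonneg fun k _ => hg _
  have hcof : Tendsto (fun s : Finset κ => Fintype.piFinset fun _ : ι => s) atTop atTop := by
    refine tendsto_atTop.2 fun T => ?_
    filter_upwards [eventually_ge_atTop (T.biUnion fun m => Finset.univ.image m)] with s hs m hm
    rw [Fintype.mem_piFinset]
    intro k
    exact hs (Finset.mem_biUnion.2 ⟨m, hm, Finset.mem_image_of_mem _ (Finset.mem_univ k)⟩)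
  have hsum : Summable fun m : ι → κ => ∏ k, g (m k) := by
    refine summable_of_sum_le hpos (c := a ^ Fintype.card ι) fun T => ?_
    refine ge_of_tendsto hbox ?_
    filter_upwards [hcof.eventually_ge_atTop T] with s hs
    exact Finset.sum_le_sum_of_subset_of_nonneg hs fun m _ _ => hpos m
  rw [tendsto_nhds_unique hbox (hsum.hasSum.comp hcof)]
  exact hsum.hasSum

variable {N : ℕ}

theorem heatKernel_nonneg {t : ℝ} (ht : 0 ≤ t) (m : Fin N → ℤ) : 0 ≤ heatKernel N t m :=
  Finset.prod_nonneg fun _ _ => heatKernel₁_nonneg ht _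

theorem hasSum_heatKernel {t : ℝ} (ht : 0 ≤ t) : HasSum (heatKernel N t) 1 := by
  simpa [← heatKernel_eq] using
    hasSum_pi_prod_of_nonneg (ι := Fin N) (heatKernel₁_nonneg ht) (hasSum_heatKernel₁ t)

theorem heatKernel_le_one {t : ℝ} (ht : 0 ≤ t) (m : Fin N → ℤ) : heatKernel N t m ≤ 1 :=
  le_hasSum (hasSum_heatKernel ht) m fun _ _ => heatKernel_nonneg ht _

theorem hasSum_heatKernel_ne_zero {t : ℝ} (ht : 0 ≤ t) :
    HasSum (fun m : {m : Fin N → ℤ // m ≠ 0} => heatKernel N t m) (1 - heatKernel N t 0) := by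
  have h0 : HasSum (heatKernel N t ∘ ((↑) : ({0} : Set (Fin N → ℤ)) → Fin N → ℤ))
      (heatKernel N t 0) := hasSum_unique _
  exact h0.hasSum_iff_compl.1 (hasSum_heatKernel ht)

theorem one_sub_heatKernel_zero_le {t : ℝ} (ht : 0 ≤ t) : 1 - heatKernel N t 0 ≤ 2 * N * t := by
  have h1 : Real.exp (-2 * t) ^ N ≤ heatKernel N t 0 := by
    rw [heatKernel_eq]
    simpa using Finset.prod_le_prod (s := (Finset.univ : Finset (Fin N)))
      (fun _ _ => (Real.exp_pos (-2 * t)).le) (fun _ _ => exp_le_heatKernel₁_zero ht)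
  rw [← Real.exp_nat_mul] at h1
  linarith [Real.add_one_le_exp (N * (-2 * t))]

theorem heatKernel_le_mul {t : ℝ} (ht : 0 ≤ t) {m : Fin N → ℤ} (hm : m ≠ 0) :
    heatKernel N t m ≤ 2 * N * t :=
  (le_hasSum (hasSum_heatKernel_ne_zero ht) ⟨m, hm⟩ fun _ _ => heatKernel_nonneg ht _).trans
    (one_sub_heatKernel_zero_le ht)

theorem heatKernel₁_le {t : ℝ} (ht : 0 < t) (a : ℤ) :
    heatKernel₁ t a ≤ Real.pi * t ^ (-(1 / 2) : ℝ) := by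
  have hpi := Real.pi_pos
  have hb : 0 < t * (4 / Real.pi ^ 2) := by positivity
  have hint := integrable_exp_neg_mul_sq hb
  calc heatKernel₁ t a
      ≤ ∫ x, Real.exp (-(t * (4 / Real.pi ^ 2)) * x ^ 2) ∂circleMeasure := by
        rw [heatKernel₁_eq_integral]
        refine setIntegral_mono_on
          (integrable_circleMeasure (by fun_prop)) hint.integrableOn measurableSet_Ioc
          fun x hx => ?_
        have hx' : |x| ≤ Real.pi := abs_le.2 ⟨hx.1.le, hx.2⟩
        have h1 := Real.cos_le_one_sub_mul_cos_sq hx'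
        have h2 : Real.cos (a * x) / (2 * Real.pi) ≤ 1 := by
          rw [div_le_one (by positivity)]
          linarith [Real.cos_le_one (a * x), Real.pi_gt_three]
        refine (mul_le_of_le_one_right (Real.exp_pos _).le h2).trans (Real.exp_le_exp.2 ?_)
        have : t * (2 * Real.cos x - 2) ≤ t * (2 * (1 - 2 / Real.pi ^ 2 * x ^ 2) - 2) := by gcongr
        refine this.trans_eq ?_
        ring
    _ ≤ ∫ x, Real.exp (-(t * (4 / Real.pi ^ 2)) * x ^ 2) :=
        setIntegral_le_integral hint (Eventually.of_forall fun x => (Real.exp_pos _).le)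
    _ = √(Real.pi ^ 3 / 4) * t ^ (-(1 / 2) : ℝ) := by
        rw [integral_gaussian, Real.rpow_neg ht.le, ← Real.sqrt_eq_rpow, ← Real.sqrt_inv,
          ← Real.sqrt_mul (by positivity)]
        congr 1
        field_simp
    _ ≤ _ := by
        gcongr
        rw [Real.sqrt_le_left hpi.le]
        nlinarith [Real.pi_lt_four, sq_nonneg Real.pi]

theorem heatKernel_le_rpow {t : ℝ} (ht : 0 < t) (m : Fin N → ℤ) :
    heatKernel N t m ≤ Real.pi ^ N * t ^ (-(N / 2) : ℝ) := by
  rw [heatKernel_eq]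
  refine (Finset.prod_le_prod (fun _ _ => heatKernel₁_nonneg ht.le _)
    (fun k _ => heatKernel₁_le ht (m k))).trans_eq ?_
  rw [Finset.prod_const, Finset.card_univ, Fintype.card_fin, mul_pow, ← Real.rpow_natCast (t ^ _),
    ← Real.rpow_mul ht.le]
  congr 2
  ring


/-! ### The kernel of the Riesz potential near `s = 0` -/

/-- The heat kernel with its mass at the origin removed for `t ≤ 1`. -/
noncomputable def truncKernel (N : ℕ) (t : ℝ) (m : Fin N → ℤ) : ℝ :=
  heatKernel N t m - if m = 0 ∧ t ≤ 1 then 1 else 0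

/-- A bound for `|truncKernel N t m| / t`, uniform in `m`. -/
noncomputable def truncBound (N : ℕ) (t : ℝ) : ℝ :=
  if t ≤ 1 then 2 * N else Real.pi ^ N * t ^ (-(N / 2) - 1 : ℝ)

theorem truncBound_nonneg {t : ℝ} (ht : 0 < t) : 0 ≤ truncBound N t := by
  unfold truncBound
  split_ifs <;> positivity

theorem measurable_truncBound : Measurable (truncBound N) := by
  unfold truncBound
  exact Measurable.ite measurableSet_Iic measurable_const (by fun_prop)

theorem measurable_truncKernel (m : Fin N → ℤ) : Measurable fun t => truncKernel N t m := by
  unfold truncKernel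
  refine (continuous_heatKernel N m).measurable.sub ?_
  by_cases hm : m = 0
  · simp only [hm, true_and]
    exact Measurable.ite measurableSet_Iic measurable_const measurable_const
  · simp [hm]

theorem abs_truncKernel_div_le {t : ℝ} (ht : 0 < t) (m : Fin N → ℤ) :
    |truncKernel N t m / t| ≤ truncBound N t := by
  rw [abs_div, abs_of_pos ht, div_le_iff₀ ht]
  unfold truncKernel truncBound
  split_ifs with h1 h2 h2
  · obtain ⟨rfl, -⟩ := h1
    rw [abs_sub_comm, abs_of_nonneg (by linarith [heatKernel_le_one ht.le (0 : Fin N → ℤ)])]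
    exact one_sub_heatKernel_zero_le ht.le
  · exact absurd h1.2 h2
  · rw [sub_zero, abs_of_nonneg (heatKernel_nonneg ht.le m)]
    exact heatKernel_le_mul ht.le fun hm => h1 ⟨hm, h2⟩
  · rw [sub_zero, abs_of_nonneg (heatKernel_nonneg ht.le m), mul_assoc,
      Real.rpow_sub_one ht.ne', div_mul_cancel₀ _ ht.ne']
    exact heatKernel_le_rpow ht m

theorem integrableOn_truncBound_mul_rpow {σ : ℝ} (h0 : 0 ≤ σ) (h1 : σ < N / 2) :
    IntegrableOn (fun t => truncBound N t * t ^ σ) (Set.Ioi 0) := by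
  rw [← Set.Ioc_union_Ioi_eq_Ioi zero_le_one]
  refine IntegrableOn.union ?_ ?_
  · refine IntegrableOn.of_bound measure_Ioc_lt_top
      (measurable_truncBound.mul (by fun_prop)).aestronglyMeasurable (2 * N)
      (ae_restrict_of_forall_mem measurableSet_Ioc fun t ht => ?_)
    rw [Real.norm_eq_abs, abs_of_nonneg
      (mul_nonneg (truncBound_nonneg ht.1) (Real.rpow_nonneg ht.1.le _)), truncBound, if_pos ht.2]
    exact mul_le_of_le_one_right (by positivity) (Real.rpow_le_one ht.1.le ht.2 h0)
  · have h := (integrableOn_Ioi_rpow_of_lt (a := -(N / 2) - 1 + σ) (c := 1) (by linarith)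
      one_pos).const_mul (Real.pi ^ N)
    refine IntegrableOn.congr_fun h (fun t ht => ?_) measurableSet_Ioi
    have ht' : (1 : ℝ) < t := ht
    simp only [truncBound]
    rw [if_neg ht'.not_ge, mul_assoc, ← Real.rpow_add (by linarith)]

theorem integrableOn_truncBound (hN : 1 ≤ N) : IntegrableOn (truncBound N) (Set.Ioi 0) := by
  have : (1 : ℝ) ≤ N := by exact_mod_cast hN
  simpa using integrableOn_truncBound_mul_rpow (N := N) le_rfl (by linarith)

theorem integrableOn_truncKernel_mul_rpow {σ : ℝ} (h0 : 0 ≤ σ) (h1 : σ < N / 2)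
    (m : Fin N → ℤ) : IntegrableOn (fun t => truncKernel N t m / t * t ^ σ) (Set.Ioi 0) := by
  refine (integrableOn_truncBound_mul_rpow h0 h1).mono'
    (((measurable_truncKernel m).div measurable_id).mul (by fun_prop)).aestronglyMeasurable
    (ae_restrict_of_forall_mem measurableSet_Ioi fun t ht => ?_)
  rw [norm_mul, Real.norm_eq_abs, Real.norm_eq_abs, abs_of_nonneg (Real.rpow_nonneg ht.le σ)]
  have := abs_truncKernel_div_le ht m
  have ht' : 0 < t := ht
  gcongr

theorem integrableOn_truncKernel_div (hN : 1 ≤ N) (m : Fin N → ℤ) :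
    IntegrableOn (fun t => truncKernel N t m / t) (Set.Ioi 0) := by
  have : (1 : ℝ) ≤ N := by exact_mod_cast hN
  simpa using integrableOn_truncKernel_mul_rpow (N := N) le_rfl (by linarith) m

theorem hasIntegral_Ioc_rpow {σ : ℝ} (h : 0 < σ) :
    IntegrableOn (fun t : ℝ => t ^ (σ - 1)) (Set.Ioc 0 1) ∧
      ∫ t in Set.Ioc (0 : ℝ) 1, t ^ (σ - 1) = σ⁻¹ := by
  constructor
  · exact (intervalIntegrable_iff_integrableOn_Ioc_of_le zero_le_one).1
      (intervalIntegral.intervalIntegrable_rpow' (by linarith))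
  · rw [← intervalIntegral.integral_of_le zero_le_one, integral_rpow (Or.inl (by linarith))]
    simp [Real.zero_rpow h.ne']

theorem heatKernel_div_mul_rpow_eq (σ : ℝ) (m : Fin N → ℤ) {t : ℝ} (ht : 0 < t) :
    heatKernel N t m / t * t ^ σ = truncKernel N t m / t * t ^ σ +
      (if m = 0 then 1 else 0) * (Set.Ioc (0 : ℝ) 1).indicator (fun t => t ^ (σ - 1)) t := by
  have h : t ^ (σ - 1) = 1 / t * t ^ σ := by rw [Real.rpow_sub_one ht.ne']; ring
  unfold truncKernel Set.indicator
  by_cases hm : m = 0 <;> by_cases h1 : t ≤ 1 <;> simp [hm, h1, ht, h] <;> ring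

theorem integrableOn_heatKernel_mul_rpow {σ : ℝ} (h0 : 0 < σ) (h1 : σ < N / 2) (m : Fin N → ℤ) :
    IntegrableOn (fun t => heatKernel N t m / t * t ^ σ) (Set.Ioi 0) ∧
      ∫ t in Set.Ioi 0, heatKernel N t m / t * t ^ σ =
        (∫ t in Set.Ioi 0, truncKernel N t m / t * t ^ σ) + (if m = 0 then 1 else 0) * σ⁻¹ := by
  have hI := integrableOn_truncKernel_mul_rpow h0.le h1 m
  obtain ⟨hr, hv⟩ := hasIntegral_Ioc_rpow h0
  have hJ : IntegrableOn ((Set.Ioc (0 : ℝ) 1).indicator fun t => t ^ (σ - 1)) (Set.Ioi 0) :=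
    ((integrable_indicator_iff measurableSet_Ioc).2 hr).integrableOn
  have hval : ∫ t in Set.Ioi 0, (Set.Ioc (0 : ℝ) 1).indicator (fun t => t ^ (σ - 1)) t = σ⁻¹ := by
    rw [setIntegral_indicator measurableSet_Ioc,
      Set.inter_eq_right.2 Set.Ioc_subset_Ioi_self, hv]
  have heq : Set.EqOn (fun t => heatKernel N t m / t * t ^ σ) _ (Set.Ioi 0) :=
    fun t ht => heatKernel_div_mul_rpow_eq σ m ht
  constructor
  · exact (hI.add (hJ.const_mul _)).congr_fun heq.symm measurableSet_Ioi
  · rw [setIntegral_congr_fun measurableSet_Ioi heq, integral_add hI (hJ.const_mul _),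
      integral_const_mul, hval]

/-- The convolution kernel of `(-Δ)^{-σ}`. -/
noncomputable def rieszKernel (N : ℕ) (σ : ℝ) (m : Fin N → ℤ) : ℝ :=
  (Real.Gamma σ)⁻¹ * ∫ t in Set.Ioi 0, heatKernel N t m / t * t ^ σ

theorem rieszKernel_eq {σ : ℝ} (h0 : 0 < σ) (h1 : σ < N / 2) (m : Fin N → ℤ) :
    rieszKernel N σ m = (Real.Gamma (σ + 1))⁻¹ *
      (σ * (∫ t in Set.Ioi 0, truncKernel N t m / t * t ^ σ) + if m = 0 then 1 else 0) := by
  rw [rieszKernel, (integrableOn_heatKernel_mul_rpow h0 h1 m).2, Real.Gamma_add_one h0.ne']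
  have := (Real.Gamma_pos_of_pos h0).ne'
  field_simp

theorem abs_rieszKernel_le {σ : ℝ} (h0 : 0 < σ) (h1 : σ < N / 2) (m : Fin N → ℤ) :
    |rieszKernel N σ m| ≤ (Real.Gamma (σ + 1))⁻¹ *
      (σ * (∫ t in Set.Ioi 0, truncBound N t * t ^ σ) + 1) := by
  have hΓ := Real.Gamma_pos_of_pos (by linarith : 0 < σ + 1)
  rw [rieszKernel_eq h0 h1, abs_mul, abs_of_pos (inv_pos.2 hΓ)]
  gcongr
  refine (abs_add_le _ _).trans (add_le_add ?_ (by split_ifs <;> simp))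
  rw [abs_mul, abs_of_pos h0]
  gcongr
  rw [← Real.norm_eq_abs]
  refine norm_integral_le_of_norm_le (integrableOn_truncBound_mul_rpow h0.le h1)
    (ae_restrict_of_forall_mem measurableSet_Ioi fun t ht => ?_)
  have ht' : 0 < t := ht
  rw [norm_mul, Real.norm_eq_abs, Real.norm_eq_abs, abs_of_nonneg (Real.rpow_nonneg ht'.le σ)]
  have := abs_truncKernel_div_le ht' m
  gcongr

/-- The convolution kernel of `-log(-Δ)`. -/
noncomputable def logKernel (N : ℕ) (m : Fin N → ℤ) : ℝ :=
  (∫ t in Set.Ioi 0, truncKernel N t m / t) +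
    (if m = 0 then 1 else 0) * Real.eulerMascheroniConstant

/-- The distance between `t^σ` and `1` in the weight `truncBound`. -/
noncomputable def rpowDefect (N : ℕ) (σ : ℝ) : ℝ :=
  ∫ t in Set.Ioi 0, truncBound N t * |t ^ σ - 1|

theorem abs_rpow_sub_one_le {σ t : ℝ} (h0 : 0 < σ) (h1 : σ ≤ 1 / 4) (ht : 0 < t) :
    |t ^ σ - 1| ≤ t ^ (1 / 4 : ℝ) + 1 := by
  have h2 := Real.rpow_pos_of_pos ht σ
  have h3 := Real.rpow_pos_of_pos ht (1 / 4)
  rw [abs_le]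
  refine ⟨by linarith, ?_⟩
  rcases le_total t 1 with h | h
  · linarith [Real.rpow_le_one ht.le h h0.le]
  · linarith [Real.rpow_le_rpow_of_exponent_le h h1]

theorem integrableOn_rpowDefect_bound (hN : 1 ≤ N) :
    IntegrableOn (fun t => truncBound N t * (t ^ (1 / 4 : ℝ) + 1)) (Set.Ioi 0) := by
  have : (1 : ℝ) ≤ N := by exact_mod_cast hN
  simp only [mul_add, mul_one]
  exact (integrableOn_truncBound_mul_rpow (by norm_num) (by linarith)).add
    (integrableOn_truncBound hN)

theorem aestronglyMeasurable_rpowDefect (σ : ℝ) (μ : Measure ℝ) :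
    AEStronglyMeasurable (fun t => truncBound N t * |t ^ σ - 1|) μ :=
  (measurable_truncBound.mul (by fun_prop)).aestronglyMeasurable

theorem norm_rpowDefect_integrand_le {σ t : ℝ} (h0 : 0 < σ) (h1 : σ ≤ 1 / 4) (ht : 0 < t) :
    ‖truncBound N t * |t ^ σ - 1|‖ ≤ truncBound N t * (t ^ (1 / 4 : ℝ) + 1) := by
  rw [norm_mul, Real.norm_eq_abs, Real.norm_eq_abs, abs_abs,
    abs_of_nonneg (truncBound_nonneg ht)]
  exact mul_le_mul_of_nonneg_left (abs_rpow_sub_one_le h0 h1 ht) (truncBound_nonneg ht)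

theorem eventually_small_pos : ∀ᶠ σ : ℝ in 𝓝[>] 0, 0 < σ ∧ σ ≤ 1 / 4 := by
  filter_upwards [Ioc_mem_nhdsGT (show (0 : ℝ) < 1 / 4 by norm_num)] with σ hσ using hσ

theorem tendsto_rpowDefect (hN : 1 ≤ N) : Tendsto (rpowDefect N) (𝓝[>] 0) (𝓝 0) := by
  have h := tendsto_integral_filter_of_dominated_convergence
    (μ := volume.restrict (Set.Ioi 0)) (l := 𝓝[>] (0 : ℝ))
    (F := fun σ t => truncBound N t * |t ^ σ - 1|) (f := fun _ => 0)
    (fun t => truncBound N t * (t ^ (1 / 4 : ℝ) + 1))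
    (Eventually.of_forall fun σ => aestronglyMeasurable_rpowDefect σ _)
    (by
      filter_upwards [eventually_small_pos] with σ hσ
      exact ae_restrict_of_forall_mem measurableSet_Ioi fun t ht =>
        norm_rpowDefect_integrand_le hσ.1 hσ.2 ht)
    (integrableOn_rpowDefect_bound hN)
    (ae_restrict_of_forall_mem measurableSet_Ioi fun t ht => by
      have hc : ContinuousAt (fun σ : ℝ => truncBound N t * |t ^ σ - 1|) 0 :=
        ((Real.continuousAt_const_rpow (ne_of_gt ht)).sub continuousAt_const).abs.const_mul _
      simpa using hc.tendsto.mono_left nhdsWithin_le_nhds)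
  rw [integral_zero] at h
  exact h

theorem abs_integral_truncKernel_sub_le (hN : 1 ≤ N) {σ : ℝ} (h0 : 0 < σ) (h1 : σ ≤ 1 / 4)
    (m : Fin N → ℤ) :
    |(∫ t in Set.Ioi 0, truncKernel N t m / t * t ^ σ) - ∫ t in Set.Ioi 0, truncKernel N t m / t| ≤
      rpowDefect N σ := by
  have : (1 : ℝ) ≤ N := by exact_mod_cast hN
  rw [← integral_sub (integrableOn_truncKernel_mul_rpow h0.le (by linarith) m)
    (integrableOn_truncKernel_div hN m)]
  rw [← Real.norm_eq_abs]
  refine norm_integral_le_of_norm_le ((integrableOn_rpowDefect_bound hN).mono'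
      (aestronglyMeasurable_rpowDefect σ _) (ae_restrict_of_forall_mem measurableSet_Ioi
        fun t ht => norm_rpowDefect_integrand_le h0 h1 ht))
    (ae_restrict_of_forall_mem measurableSet_Ioi fun t ht => ?_)
  rw [← mul_sub_one, norm_mul]
  exact mul_le_mul_of_nonneg_right (abs_truncKernel_div_le ht m) (abs_nonneg _)

theorem abs_integral_truncKernel_le (hN : 1 ≤ N) (m : Fin N → ℤ) :
    |∫ t in Set.Ioi 0, truncKernel N t m / t| ≤ ∫ t in Set.Ioi 0, truncBound N t := by
  rw [← Real.norm_eq_abs]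
  exact norm_integral_le_of_norm_le (integrableOn_truncBound hN)
    (ae_restrict_of_forall_mem measurableSet_Ioi fun _ ht => abs_truncKernel_div_le ht m)

/-- A uniform bound for the error of the first-order expansion of `rieszKernel` at `σ = 0`. -/
noncomputable def expansionError (N : ℕ) (σ : ℝ) : ℝ :=
  |(Real.Gamma (σ + 1))⁻¹| * rpowDefect N σ +
    |(Real.Gamma (σ + 1))⁻¹ - 1| * (∫ t in Set.Ioi 0, truncBound N t) +
    |((Real.Gamma (σ + 1))⁻¹ - 1) / σ - Real.eulerMascheroniConstant|

theorem hasDerivAt_inv_Gamma_add_one :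
    HasDerivAt (fun σ : ℝ => (Real.Gamma (σ + 1))⁻¹) Real.eulerMascheroniConstant 0 := by
  have h : HasDerivAt (fun σ : ℝ => Real.Gamma (σ + 1)) (-Real.eulerMascheroniConstant) 0 :=
    HasDerivAt.comp_add_const 0 1 (by simpa using Real.hasDerivAt_Gamma_one)
  simpa using h.fun_inv (by simp)

theorem tendsto_expansionError (hN : 1 ≤ N) : Tendsto (expansionError N) (𝓝[>] 0) (𝓝 0) := by
  have hd := hasDerivAt_inv_Gamma_add_one
  have hc : Tendsto (fun σ : ℝ => (Real.Gamma (σ + 1))⁻¹) (𝓝[>] 0) (𝓝 1) := by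
    simpa using hd.continuousAt.tendsto.mono_left (nhdsWithin_le_nhds (s := Set.Ioi 0))
  have hs : Tendsto (fun σ : ℝ => ((Real.Gamma (σ + 1))⁻¹ - 1) / σ) (𝓝[>] 0)
      (𝓝 Real.eulerMascheroniConstant) := by
    have h := (hasDerivWithinAt_iff_tendsto_slope' (by simp)).1
      (hd.hasDerivWithinAt (s := Set.Ioi 0))
    refine h.congr fun σ => ?_
    simp [slope_def_field]
  have h := ((hc.abs.mul (tendsto_rpowDefect hN)).add
    ((hc.sub_const 1).abs.mul_const (∫ t in Set.Ioi 0, truncBound N t))).add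
    ((hs.sub_const Real.eulerMascheroniConstant).abs)
  rw [sub_self, sub_self, abs_zero, mul_zero, zero_mul, add_zero, add_zero] at h
  exact h

theorem abs_rieszKernel_expansion_le (hN : 1 ≤ N) {σ : ℝ} (h0 : 0 < σ) (h1 : σ ≤ 1 / 4)
    (m : Fin N → ℤ) :
    |(rieszKernel N σ m - if m = 0 then 1 else 0) / σ - logKernel N m| ≤ expansionError N σ := by
  have : (1 : ℝ) ≤ N := by exact_mod_cast hN
  have e1 := abs_integral_truncKernel_sub_le hN h0 h1 m
  have e2 := abs_integral_truncKernel_le hN m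
  rw [rieszKernel_eq h0 (by linarith), logKernel, expansionError]
  generalize (∫ t in Set.Ioi 0, truncKernel N t m / t * t ^ σ) = A at *
  generalize (∫ t in Set.Ioi 0, truncKernel N t m / t) = L at *
  generalize (Real.Gamma (σ + 1))⁻¹ = g at *
  obtain ⟨d, hd, hd1⟩ : ∃ d : ℝ, (if m = 0 then (1 : ℝ) else 0) = d ∧ |d| ≤ 1 :=
    ⟨_, rfl, by split_ifs <;> simp⟩
  rw [hd]
  have key : (g * (σ * A + d) - d) / σ - (L + d * Real.eulerMascheroniConstant) =
      g * (A - L) + (g - 1) * L + d * ((g - 1) / σ - Real.eulerMascheroniConstant) := by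
    field_simp
    ring
  rw [key]
  refine (abs_add_three _ _ _).trans ?_
  rw [abs_mul, abs_mul, abs_mul]
  gcongr
  exact mul_le_of_le_one_left (abs_nonneg _) hd1


/-! ### The logarithm of the discrete Laplacian -/

theorem integrableOn_heatKernel_div (hN : 1 ≤ N) {m : Fin N → ℤ} (hm : m ≠ 0) :
    IntegrableOn (fun t : ℝ => heatKernel N t m / t) (Set.Ioi 0) := by
  simpa [truncKernel, hm] using integrableOn_truncKernel_div hN m

theorem integrableOn_heatKernel_zero_div (hN : 1 ≤ N) :
    IntegrableOn (fun t : ℝ => heatKernel N t 0 / t) (Set.Ioi 1) := by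
  refine ((integrableOn_truncKernel_div hN 0).mono_set
    (Set.Ioi_subset_Ioi zero_le_one)).congr_fun (fun t ht => ?_) measurableSet_Ioi
  have ht' : (1 : ℝ) < t := ht
  simp [truncKernel, ht'.not_ge]

theorem integrableOn_one_sub_heatKernel_zero_div (hN : 1 ≤ N) :
    IntegrableOn (fun t : ℝ => (1 - heatKernel N t 0) / t) (Set.Ioc 0 1) := by
  refine ((integrableOn_truncKernel_div hN 0).mono_set Set.Ioc_subset_Ioi_self).neg.congr_fun
    (fun t ht => ?_) measurableSet_Ioc
  simp [truncKernel, ht.2, ← neg_div]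

theorem hasSum_integral_heatKernel_div (hN : 1 ≤ N) :
    HasSum (fun m : {m : Fin N → ℤ // m ≠ 0} => ∫ t in Set.Ioc (0 : ℝ) 1, heatKernel N t m / t)
      (∫ t in Set.Ioc (0 : ℝ) 1, (1 - heatKernel N t 0) / t) := by
  have hI : ∀ m : {m : Fin N → ℤ // m ≠ 0},
      IntegrableOn (fun t : ℝ => heatKernel N t m / t) (Set.Ioc 0 1) := fun m =>
    (integrableOn_heatKernel_div hN m.2).mono_set Set.Ioc_subset_Ioi_self
  have hpt : ∀ t ∈ Set.Ioc (0 : ℝ) 1, HasSum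
      (fun m : {m : Fin N → ℤ // m ≠ 0} => heatKernel N t m / t) ((1 - heatKernel N t 0) / t) :=
    fun t ht => (hasSum_heatKernel_ne_zero ht.1.le).div_const t
  have hnn : ∀ m : {m : Fin N → ℤ // m ≠ 0}, ∀ t ∈ Set.Ioc (0 : ℝ) 1, 0 ≤ heatKernel N t m / t :=
    fun m t ht => div_nonneg (heatKernel_nonneg ht.1.le _) ht.1.le
  have hs : Summable fun m : {m : Fin N → ℤ // m ≠ 0} =>
      ∫ t in Set.Ioc (0 : ℝ) 1, heatKernel N t m / t := by
    refine summable_of_sum_le (fun m => setIntegral_nonneg measurableSet_Ioc (hnn m))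
      (c := ∫ t in Set.Ioc (0 : ℝ) 1, (1 - heatKernel N t 0) / t) fun T => ?_
    rw [← integral_finsetSum _ fun m _ => hI m]
    refine setIntegral_mono_on (integrable_finsetSum _ fun m _ => hI m)
      (integrableOn_one_sub_heatKernel_zero_div hN) measurableSet_Ioc fun t ht => ?_
    exact sum_le_hasSum _ (fun m _ => hnn m t ht) (hpt t ht)
  have h := hasSum_integral_of_summable_integral_norm hI (hs.congr fun m =>
    setIntegral_congr_fun measurableSet_Ioc fun t ht => by
      simp only [Real.norm_eq_abs, abs_of_nonneg (hnn m t ht)])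
  rwa [setIntegral_congr_fun measurableSet_Ioc fun t ht => (hpt t ht).tsum_eq] at h

theorem logKernel_of_ne_zero {m : Fin N → ℤ} (hm : m ≠ 0) : logKernel N m = kernelK N m := by
  simp [logKernel, kernelK, truncKernel, hm]

theorem logKernel_zero (hN : 1 ≤ N) : logKernel N 0 = -corrector N := by
  have hI := integrableOn_truncKernel_div hN 0
  rw [logKernel, corrector, (hasSum_integral_heatKernel_div hN).tsum_eq,
    ← Set.Ioc_union_Ioi_eq_Ioi (zero_le_one (α := ℝ)),
    setIntegral_union (Set.Ioc_disjoint_Ioi le_rfl) measurableSet_Ioi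
      (hI.mono_set Set.Ioc_subset_Ioi_self) (hI.mono_set (Set.Ioi_subset_Ioi zero_le_one)),
    setIntegral_congr_fun (g := fun t => -((1 - heatKernel N t 0) / t)) measurableSet_Ioc
      (fun t ht => by simp [truncKernel, ht.2, ← neg_div]),
    setIntegral_congr_fun (g := fun t => heatKernel N t 0 / t) measurableSet_Ioi
      (fun t ht => by simp [truncKernel, (show (1 : ℝ) < t from ht).not_ge]),
    integral_neg]
  simp
  ring

theorem abs_logKernel_le (hN : 1 ≤ N) (m : Fin N → ℤ) :
    |logKernel N m| ≤ (∫ t in Set.Ioi 0, truncBound N t) + |Real.eulerMascheroniConstant| := by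
  refine (abs_add_le _ _).trans (add_le_add (abs_integral_truncKernel_le hN m) ?_)
  split_ifs <;> simp

section FiniteSupport

variable {S : Finset (Fin N → ℤ)} {f : (Fin N → ℤ) → ℝ}

theorem heatSemigroup_div_rpow_eq (hS : Function.support f ⊆ S) (n : Fin N → ℤ) (s : ℝ) {t : ℝ}
    (ht : 0 < t) : heatSemigroup N t f n / t ^ (s + 1) =
      ∑ m ∈ S, f m * (heatKernel N t (n - m) / t * t ^ (-s)) := by
  rw [heatSemigroup_eq_sum hS, Finset.sum_div]
  refine Finset.sum_congr rfl fun m _ => ?_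
  rw [Real.rpow_add_one ht.ne', Real.rpow_neg ht.le]
  field_simp

theorem integrableOn_heatSemigroup_div_rpow (hS : Function.support f ⊆ S) {s : ℝ}
    (h0 : -(N : ℝ) / 2 < s) (h1 : s < 0) (n : Fin N → ℤ) :
    IntegrableOn (fun t : ℝ => heatSemigroup N t f n / t ^ (s + 1)) (Set.Ioi 0) := by
  have h : IntegrableOn (fun t : ℝ => ∑ m ∈ S, f m * (heatKernel N t (n - m) / t * t ^ (-s)))
      (Set.Ioi 0) := integrable_finsetSum _ fun m _ =>
    ((integrableOn_heatKernel_mul_rpow (by linarith) (by linarith) (n - m)).1).const_mul (f m)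
  exact IntegrableOn.congr_fun h (fun t ht => (heatSemigroup_div_rpow_eq hS n s ht).symm)
    measurableSet_Ioi

theorem negLaplacianPow_eq_sum (hS : Function.support f ⊆ S) {s : ℝ}
    (h0 : -(N : ℝ) / 2 < s) (h1 : s < 0) (n : Fin N → ℤ) :
    negLaplacianPow N s f n = ∑ m ∈ S, f m * rieszKernel N (-s) (n - m) := by
  rw [negLaplacianPow, if_neg h1.ne, setIntegral_congr_fun measurableSet_Ioi
    fun t ht => heatSemigroup_div_rpow_eq hS n s ht, integral_finsetSum]
  · simp_rw [integral_const_mul, rieszKernel, Finset.mul_sum, mul_left_comm]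
  · exact fun m _ =>
      ((integrableOn_heatKernel_mul_rpow (by linarith) (by linarith) (n - m)).1).const_mul (f m)

theorem abs_sum_mul_le {g : (Fin N → ℤ) → ℝ} {C : ℝ} (hg : ∀ m, |g m| ≤ C) (n : Fin N → ℤ) :
    |∑ m ∈ S, f m * g (n - m)| ≤ (∑ m ∈ S, |f m|) * C := by
  rw [Finset.sum_mul]
  refine (Finset.abs_sum_le_sum_abs _ _).trans (Finset.sum_le_sum fun m _ => ?_)
  rw [abs_mul]
  exact mul_le_mul_of_nonneg_left (hg _) (abs_nonneg _)

theorem memℓp_infty_of_abs_le {g : (Fin N → ℤ) → ℝ} {C : ℝ} (hg : ∀ n, |g n| ≤ C) :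
    Memℓp g ∞ := by
  refine memℓp_infty ⟨C, ?_⟩
  rintro _ ⟨n, rfl⟩
  exact hg n

theorem abs_slope_negLaplacianPow_sub_le (hN : 1 ≤ N) (hS : Function.support f ⊆ S) {s : ℝ}
    (h0 : -(1 / 4) ≤ s) (h1 : s < 0) (n : Fin N → ℤ) :
    |(negLaplacianPow N s f n - f n) / s - -∑ m ∈ S, f m * logKernel N (n - m)| ≤
      (∑ m ∈ S, |f m|) * expansionError N (-s) := by
  have hN' : (1 : ℝ) ≤ N := by exact_mod_cast hN
  have h := abs_sum_mul_le (S := S) (f := f)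
    (abs_rieszKernel_expansion_le hN (neg_pos.2 h1) (by linarith)) n
  rw [← abs_neg] at h
  convert h using 2
  rw [negLaplacianPow_eq_sum hS (by linarith) h1]
  nth_rewrite 1 [eq_sum_ite hS n]
  simp only [mul_sub, Finset.sum_sub_distrib, mul_div_assoc', ← Finset.sum_div]
  rw [div_neg]
  ring

theorem eventually_small_neg : ∀ᶠ s : ℝ in 𝓝[<] 0, -(1 / 4) ≤ s ∧ s < 0 := by
  filter_upwards [Ico_mem_nhdsLT (show (-(1 / 4) : ℝ) < 0 by norm_num)] with s hs using hs

theorem tendsto_const_mul_expansionError (hN : 1 ≤ N) (C : ℝ) :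
    Tendsto (fun s => C * expansionError N (-s)) (𝓝[<] 0) (𝓝 0) := by
  have h : Tendsto (fun s : ℝ => -s) (𝓝[<] 0) (𝓝[>] 0) := by
    simpa using tendsto_neg_nhdsLT (a := (0 : ℝ))
  simpa using ((tendsto_expansionError hN).comp h).const_mul C

theorem hasDerivWithinAt_negLaplacianPow (hN : 1 ≤ N) (hS : Function.support f ⊆ S)
    (n : Fin N → ℤ) :
    HasDerivWithinAt (fun s : ℝ => negLaplacianPow N s f n)
      (-∑ m ∈ S, f m * logKernel N (n - m)) (Set.Iic 0) 0 := by
  rw [hasDerivWithinAt_iff_tendsto_slope, Set.Iic_sdiff_right, ← tendsto_sub_nhds_zero_iff]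
  refine squeeze_zero_norm' ?_ (tendsto_const_mul_expansionError hN (∑ m ∈ S, |f m|))
  filter_upwards [eventually_small_neg] with s hs
  have h := abs_slope_negLaplacianPow_sub_le hN hS hs.1 hs.2 n
  simpa [slope_def_field, negLaplacianPow] using h

theorem logNegLaplacian_eq_neg_sum (hN : 1 ≤ N) (hS : Function.support f ⊆ S)
    (n : Fin N → ℤ) :
    logNegLaplacian N f n = -∑ m ∈ S, f m * logKernel N (n - m) :=
  (hasDerivWithinAt_negLaplacianPow hN hS n).derivWithin (uniqueDiffWithinAt_Iic 0)

theorem sum_mul_logKernel (hN : 1 ≤ N) (hS : Function.support f ⊆ S) (n : Fin N → ℤ) :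
    ∑ m ∈ S, f m * logKernel N (n - m) =
      (∑' m : {m : Fin N → ℤ // m ≠ n}, kernelK N (n - m) * f m) - corrector N * f n := by
  have h1 : ∑' m : {m : Fin N → ℤ // m ≠ n}, kernelK N (n - m) * f m =
      ∑ m ∈ S, kernelK N (n - m) * f m := by
    have h2 : Function.support (fun m => kernelK N (n - m) * f m) ⊆ {m | m ≠ n} := fun m hm => by
      rintro rfl
      simp [kernelK] at hm
    refine (tsum_subtype_eq_of_support_subset h2).trans (tsum_eq_sum fun m hm => ?_)
    rw [show f m = 0 by by_contra h; exact hm (hS h), mul_zero]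
  rw [h1]
  rw [eq_sum_ite hS n]
  rw [Finset.mul_sum, ← Finset.sum_sub_distrib]
  refine Finset.sum_congr rfl fun m _ => ?_
  by_cases h : n - m = 0
  · simp [h, logKernel_zero hN, kernelK]
    ring
  · simp [h, logKernel_of_ne_zero h, mul_comm]

end FiniteSupport

end DiscreteRiesz

open DiscreteRiesz in
theorem theorem4p1 (N : ℕ) (hN : 1 ≤ N) :
    -- the integrals and the series that define `K` and `ρ_N` converge
    ((∀ m : Fin N → ℤ, m ≠ 0 →
        IntegrableOn (fun t : ℝ => heatKernel N t m / t) (Set.Ioi 0)) ∧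
      Summable (fun m : {m : Fin N → ℤ // m ≠ 0} =>
        ∫ t in Set.Ioc (0 : ℝ) 1, heatKernel N t m / t) ∧
      IntegrableOn (fun t : ℝ => heatKernel N t 0 / t) (Set.Ioi 1)) ∧
    ∀ f : (Fin N → ℤ) → ℝ, (Function.support f).Finite →
      -- `(-Δ)^s f` is well defined and bounded for `-N/2 < s < 0`
      (∀ s : ℝ, -(N : ℝ) / 2 < s → s < 0 →
        (∀ n : Fin N → ℤ,
          IntegrableOn (fun t : ℝ => heatSemigroup N t f n / t ^ (s + 1)) (Set.Ioi 0)) ∧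
        Memℓp (negLaplacianPow N s f) ∞) ∧
      -- the left derivative at `0` exists at every point and is given by the formula
      (∀ n : Fin N → ℤ,
        HasDerivWithinAt (fun s : ℝ => negLaplacianPow N s f n)
          (logNegLaplacian N f n) (Set.Iic 0) 0 ∧
        logNegLaplacian N f n =
          -(∑' m : {m : Fin N → ℤ // m ≠ n}, kernelK N (n - m) * f m) + corrector N * f n) ∧
      -- `log(-Δ) f ∈ ℓ^∞`, and the difference quotients converge to it in the norm of `ℓ^∞`
      Memℓp (logNegLaplacian N f) ∞ ∧
      Tendsto
        (fun s : ℝ => ⨆ n : Fin N → ℤ,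
          |(negLaplacianPow N s f n - f n) / s - logNegLaplacian N f n|)
        (𝓝[<] 0) (𝓝 0) := by
  refine ⟨⟨fun m hm => integrableOn_heatKernel_div hN hm,
    (hasSum_integral_heatKernel_div hN).summable, integrableOn_heatKernel_zero_div hN⟩,
    fun f hf => ?_⟩
  obtain ⟨S, hS⟩ : ∃ S : Finset (Fin N → ℤ), Function.support f ⊆ S := ⟨hf.toFinset, by simp⟩
  refine ⟨fun s h0 h1 => ⟨integrableOn_heatSemigroup_div_rpow hS h0 h1, ?_⟩, fun n => ⟨?_, ?_⟩,
    ?_, ?_⟩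
  · have hκ := abs_rieszKernel_le (N := N) (neg_pos.2 h1) (by linarith)
    refine memℓp_infty_of_abs_le (C := (∑ m ∈ S, |f m|) * ((Real.Gamma (-s + 1))⁻¹ *
      (-s * (∫ t in Set.Ioi 0, truncBound N t * t ^ (-s)) + 1))) fun n => ?_
    rw [negLaplacianPow_eq_sum hS h0 h1]
    exact abs_sum_mul_le hκ n
  · rw [logNegLaplacian_eq_neg_sum hN hS]
    exact hasDerivWithinAt_negLaplacianPow hN hS n
  · rw [logNegLaplacian_eq_neg_sum hN hS, sum_mul_logKernel hN hS]
    ring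
  · refine memℓp_infty_of_abs_le (C := (∑ m ∈ S, |f m|) *
      ((∫ t in Set.Ioi 0, truncBound N t) + |Real.eulerMascheroniConstant|)) fun n => ?_
    rw [logNegLaplacian_eq_neg_sum hN hS, abs_neg]
    exact abs_sum_mul_le (abs_logKernel_le hN) n
  · refine squeeze_zero' (Eventually.of_forall fun s => Real.iSup_nonneg fun n => abs_nonneg _) ?_
      (tendsto_const_mul_expansionError hN (∑ m ∈ S, |f m|))
    filter_upwards [eventually_small_neg] with s hs
    refine ciSup_le fun n => ?_
    rw [logNegLaplacian_eq_neg_sum hN hS]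
    exact abs_slope_negLaplacianPow_sub_le hN hS hs.1 hs.2 n
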